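/- Call a topological space scattered if each of its nonempty closed subsets $C$ contains a point that is isolated in $C$. For a compact Hausdorff space $K$, let $\mathcal C(K)$ be the Banach space of all continuous real-valued functions on $K$ with the supremum norm. If $K_1$ and $K_2$ are compact Hausdorff spaces neither of which is scattered, then $\mathcal C(K_1\times K_2)$ contains a complemented copy of $\mathcal C([0,1])$; that is, there is a linear subspace $E\subseteq\mathcal C(K_1\times K_2)$ which is the range of a continuous linear projection of $\mathcal C(K_1\times K_2)$ onto $E$ and which is isomorphic to $\mathcal C([0,1])$ as a Banach space (by a linear homeomorphism). -/

import Mathlib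

/-- A topological space is scattered if every nonempty closed subset `C` of it contains a point
that is isolated in `C` (for the subspace topology). -/
def IsScatteredSpace (X : Type*) [TopologicalSpace X] : Prop :=
  ∀ C : Set X, IsClosed C → C.Nonempty → ∃ x ∈ C, ∃ U : Set X, IsOpen U ∧ U ∩ C = {x}

/-!
A compact Hausdorff space that is not scattered contains a perfect set, hence a Cantor tree of
closed sets, and so maps continuously onto `[0, 1]` and onto the circle `𝕋`
(`exists_surjective_unitAddCircle`). Fix such surjections `fᵢ : Kᵢ → 𝕋` and lift Haar measure along
them to probability measures `μᵢ` on `Kᵢ` (`exists_measurePreserving_of_surjective`).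

The map `φ = f₁ + f₂ : K₁ × K₂ → 𝕋` then sends `ν = μ₁ × μ₂` to Haar measure, and
`g ↦ g ∘ φ` embeds `C(𝕋)` in `C(K₁ × K₂)`. A left inverse of this embedding is the conditional
expectation along `φ`, sending `h` to the density of the image of `h ν` under `φ`. The key point is
that this density is continuous. For `h = h₁ ⊗ h₂` it is a convolution of two square
integrable functions on the circle, whose Fourier series converges absolutely
(`exists_density_elementaryTensor`). Since the density is bounded by `‖h‖`
(`le_of_forall_integral_eq`) and such tensors span a dense subspace, continuity passes to all `h`
(`exists_leftInverse_comp_add`).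

Finally `[0, 1]` is a retract of `𝕋`, so `C([0, 1])` is complemented in `C(𝕋)`, and composing the two
embeddings and their left inverses gives the complemented copy of `C([0, 1])` in `C(K₁ × K₂)`.
-/

open MeasureTheory AddCircle

/-! ### Non-scattered compact spaces map onto the circle -/

theorem exists_perfect_of_not_isScatteredSpace {K : Type*} [TopologicalSpace K]
    (hK : ¬ IsScatteredSpace K) : ∃ C : Set K, Perfect C ∧ C.Nonempty := by
  unfold IsScatteredSpace at hK
  push Not at hK
  obtain ⟨C, hC, hne, h⟩ := hK
  refine ⟨C, ⟨hC, fun x hx => ?_⟩, hne⟩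
  rw [accPt_iff_nhds]
  intro U hU
  obtain ⟨V, hVU, hV, hxV⟩ := mem_nhds_iff.1 hU
  by_contra! hcon
  exact h x hx V hV (Set.eq_singleton_iff_unique_mem.2
    ⟨⟨hxV, hx⟩, fun y hy => hcon y ⟨hVU hy.1, hy.2⟩⟩)

/-- A perfect set carries a dyadic tree of nonempty closed sets with disjoint siblings, obtained by
iterating `Perfect.splitting`. -/
theorem exists_cantorScheme_of_perfect {K : Type*} [TopologicalSpace K] [T25Space K] {C : Set K}
    (hC : Perfect C) (hne : C.Nonempty) :
    ∃ A : List Bool → Set K, (∀ l, IsClosed (A l)) ∧ (∀ l, (A l).Nonempty) ∧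
      CantorScheme.Antitone A ∧ CantorScheme.Disjoint A := by
  choose S₀ S₁ h₀ h₁ hd using fun P : {S : Set K // Perfect S ∧ S.Nonempty} =>
    P.2.1.splitting P.2.2
  let A : List Bool → {S : Set K // Perfect S ∧ S.Nonempty} := fun l =>
    List.rec ⟨C, hC, hne⟩ (fun b _ P => bif b then ⟨S₁ P, (h₁ P).1, (h₁ P).2.1⟩
      else ⟨S₀ P, (h₀ P).1, (h₀ P).2.1⟩) l
  refine ⟨fun l => (A l).1, fun l => (A l).2.1.closed, fun l => (A l).2.2, ?_, ?_⟩
  · rintro l (_ | _)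
    · exact (h₀ (A l)).2.2
    · exact (h₁ (A l)).2.2
  · rintro l (_ | _) (_ | _) hab
    · exact absurd rfl hab
    · exact hd (A l)
    · exact (hd (A l)).symm
    · exact absurd rfl hab

/-- A dyadic tree of nonempty closed sets with disjoint siblings yields a continuous surjection onto
`[0, 1]`: the points lying on a branch of the tree form a closed set mapping continuously onto the
Cantor space, hence onto `[0, 1]`, and this map extends to the whole space by Tietze's theorem. -/
theorem exists_surjective_unitInterval {K : Type*} [TopologicalSpace K] [CompactSpace K]
    [T2Space K] {A : List Bool → Set K} (hcl : ∀ l, IsClosed (A l)) (hne : ∀ l, (A l).Nonempty)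
    (hanti : CantorScheme.Antitone A) (hdisj : CantorScheme.Disjoint A) :
    ∃ f : C(K, unitInterval), Function.Surjective f := by
  -- `G` relates a point to the branches through it. The cylinder condition restates
  -- `∀ n, p.1 ∈ A (PiNat.res p.2 n)` in a form from which closedness is evident.
  let G : Set (K × (ℕ → Bool)) := {p | ∀ y n, p.2 ∈ PiNat.cylinder y n → p.1 ∈ A (PiNat.res y n)}
  have hG : ∀ p, p ∈ G ↔ ∀ n, p.1 ∈ A (PiNat.res p.2 n) := by
    refine fun p => ⟨fun h n => h p.2 n (PiNat.self_mem_cylinder (E := fun _ => Bool) _ _),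
      fun h y n hy => ?_⟩
    rw [PiNat.cylinder_eq_res] at hy
    exact (show PiNat.res p.2 n = PiNat.res y n from hy) ▸ h n
  have hGcl : IsClosed G := by
    simp only [G, Set.ofPred_forall]
    refine isClosed_iInter fun y => isClosed_iInter fun n => isClosed_imp ?_ ?_
    · exact (PiNat.isOpen_cylinder (fun _ => Bool) y n).preimage continuous_snd
    · exact (hcl _).preimage continuous_fst
  have : CompactSpace G := isCompact_iff_compactSpace.1 hGcl.isCompact
  -- By disjointness of siblings only one branch passes through a given point, so `G` embeds in `K`.
  have hinj : Function.Injective fun p : G => p.1.1 := by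
    rintro ⟨⟨a, x⟩, hx⟩ ⟨⟨b, y⟩, hy⟩ (rfl : a = b)
    rw [hG] at hx hy
    have hres : ∀ n, PiNat.res x n = PiNat.res y n := by
      intro n
      induction n with
      | zero => rfl
      | succ n ih =>
        have h1 := hx (n + 1)
        have h2 := hy (n + 1)
        simp only [PiNat.res_succ] at h1 h2 ⊢
        rw [← ih] at h2 ⊢
        by_contra hne'
        exact (hdisj _ fun h => hne' (by rw [h])).le_bot ⟨h1, h2⟩
    have : x = y := PiNat.res_injective (funext hres)
    subst this
    rfl
  have hemb : Topology.IsClosedEmbedding fun p : G => p.1.1 :=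
    (continuous_fst.comp continuous_subtype_val).isClosedEmbedding hinj
  have hsurj : Function.Surjective fun p : G => p.1.2 := by
    intro x
    obtain ⟨a, ha⟩ := IsCompact.nonempty_iInter_of_sequence_nonempty_isCompact_isClosed
      (fun n => A (PiNat.res x n)) (fun n => hanti _ _) (fun n => hne _)
      (hcl _).isCompact (fun n => hcl _)
    exact ⟨⟨(a, x), (hG _).2 (Set.mem_iInter.1 ha)⟩, rfl⟩
  obtain ⟨q, hq, hqs⟩ := exists_nat_bool_continuous_surjective_of_compact unitInterval
  obtain ⟨f, hf⟩ := ContinuousMap.exists_extension' hemb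
    (⟨fun p : G => q p.1.2, by fun_prop⟩ : C(G, unitInterval))
  refine ⟨f, fun t => ?_⟩
  obtain ⟨p, hp⟩ := (hqs.comp hsurj) t
  exact ⟨p.1.1, (congrFun hf p).trans hp⟩

theorem exists_surjective_unitAddCircle {K : Type*} [TopologicalSpace K] [CompactSpace K]
    [T2Space K] (hK : ¬ IsScatteredSpace K) :
    ∃ f : C(K, UnitAddCircle), Function.Surjective f := by
  obtain ⟨C, hC, hne⟩ := exists_perfect_of_not_isScatteredSpace hK
  obtain ⟨A, h1, h2, h3, h4⟩ := exists_cantorScheme_of_perfect hC hne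
  obtain ⟨f, hf⟩ := exists_surjective_unitInterval h1 h2 h3 h4
  refine ⟨⟨fun x => ((f x : ℝ) : UnitAddCircle), by fun_prop⟩, fun z => ?_⟩
  obtain ⟨t, ht, rfl⟩ : z ∈ ((↑) : ℝ → UnitAddCircle) '' Set.Icc 0 (0 + 1) := by
    rw [AddCircle.coe_image_Icc_eq]; trivial
  obtain ⟨x, hx⟩ := hf ⟨t, by simpa using ht⟩
  exact ⟨x, by simp [hx]⟩

/-! ### Lifting a probability measure along a surjection -/

/-- Every probability measure on `X` is the image of a probability measure on a compact Hausdorff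
space `K` mapping onto `X`: integration against `m` is a positive functional on the copy of
`C(X, ℝ)` in `C(K, ℝ)`, it extends positively by M. Riesz' theorem, and the extension is represented
by a measure. -/
theorem exists_measurePreserving_of_surjective {K X : Type*} [TopologicalSpace K] [CompactSpace K]
    [T2Space K] [MeasurableSpace K] [BorelSpace K] [TopologicalSpace X] [CompactSpace X]
    [MeasurableSpace X] [BorelSpace X] [HasOuterApproxClosed X] (m : Measure X)
    [IsProbabilityMeasure m] (f : C(K, X)) (hf : Function.Surjective f) :
    ∃ μ : Measure K, IsProbabilityMeasure μ ∧ MeasurePreserving f μ m := by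
  let J : C(X, ℝ) →ₗ[ℝ] C(K, ℝ) := (ContinuousMap.compRightAlgHom ℝ ℝ f).toLinearMap
  have hJ : Function.Injective J := fun g g' h => by
    ext x
    obtain ⟨k, rfl⟩ := hf x
    exact congr($h k)
  have hint : ∀ g : C(X, ℝ), Integrable g m := fun g =>
    g.continuous.integrable_of_hasCompactSupport (HasCompactSupport.of_compactSpace g)
  let I : C(X, ℝ) →ₗ[ℝ] ℝ :=
    { toFun := fun g => ∫ x, g x ∂m
      map_add' := fun g g' => integral_add (hint g) (hint g')
      map_smul' := fun c g => integral_const_mul c g }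
  let e := LinearEquiv.ofInjective J hJ
  let F : C(K, ℝ) →ₗ.[ℝ] ℝ := ⟨LinearMap.range J, I ∘ₗ e.symm.toLinearMap⟩
  have hF : ∀ g, F (e g) = ∫ x, g x ∂m := fun g => by
    change I (e.symm (e g)) = _
    rw [e.symm_apply_apply]; rfl
  obtain ⟨Λ, hΛ, hpos⟩ := riesz_extension (PointedCone.positive ℝ C(K, ℝ)) F (by
    intro x hx
    obtain ⟨g, rfl⟩ := e.surjective x
    rw [hF]
    refine integral_nonneg fun y => ?_
    obtain ⟨k, rfl⟩ := hf y
    exact ((PointedCone.mem_positive ℝ _).1 hx : (0 : C(K, ℝ)) ≤ J g) k) (by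
    intro y
    refine ⟨e (ContinuousMap.const X ‖y‖), ?_⟩
    rw [PointedCone.mem_positive]
    intro k
    have : -‖y‖ ≤ y k := (abs_le.1 (y.norm_coe_le_norm k)).1
    change 0 ≤ ‖y‖ + y k
    linarith)
  let Λ' : CompactlySupportedContinuousMap K ℝ →ₗ[ℝ] ℝ :=
    { toFun := fun g => Λ g.toContinuousMap
      map_add' := fun g g' => Λ.map_add _ _
      map_smul' := fun c g => Λ.map_smul c _ }
  let P : CompactlySupportedContinuousMap K ℝ →ₚ[ℝ] ℝ := PositiveLinearMap.mk₀ Λ' fun g hg =>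
    hpos _ ((PointedCone.mem_positive ℝ _).2 fun k => hg k)
  let μ := RealRMK.rieszMeasure P
  have hμ : ∀ g : C(X, ℝ), ∫ k, g (f k) ∂μ = ∫ x, g x ∂m := fun g => by
    rw [← hF, ← hΛ]
    exact RealRMK.integral_rieszMeasure P
      (CompactlySupportedContinuousMap.continuousMapEquiv (J g))
  have : IsFiniteMeasure μ := inferInstance
  have hmp : MeasurePreserving f μ m := by
    refine ⟨f.continuous.measurable, ?_⟩
    refine ext_of_forall_integral_eq_of_IsFiniteMeasure fun g => ?_
    rw [integral_map f.continuous.measurable.aemeasurable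
      g.continuous.aestronglyMeasurable]
    exact hμ g.toContinuousMap
  refine ⟨μ, ⟨?_⟩, hmp⟩
  rw [← Set.preimage_univ (f := f), hmp.measure_preimage nullMeasurableSet_univ, measure_univ]

/-- If `f₁` and `f₂` push their measures to an invariant probability measure `m`, so does
`f₁ + f₂` on the product: by invariance, `m ∗ m = m`. -/
theorem measurePreserving_add_of_prod {Ω₁ Ω₂ G : Type*} [MeasurableSpace Ω₁] [MeasurableSpace Ω₂]
    [MeasurableSpace G] [AddGroup G] [MeasurableAdd₂ G]
    {μ₁ : Measure Ω₁} {μ₂ : Measure Ω₂} [SFinite μ₁] [SFinite μ₂] {m : Measure G}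
    [IsProbabilityMeasure m] [m.IsAddLeftInvariant] {f₁ : Ω₁ → G} {f₂ : Ω₂ → G}
    (h₁ : MeasurePreserving f₁ μ₁ m) (h₂ : MeasurePreserving f₂ μ₂ m) :
    MeasurePreserving (fun p : Ω₁ × Ω₂ => f₁ p.1 + f₂ p.2) (μ₁.prod μ₂) m :=
  measurePreserving_snd.comp ((measurePreserving_prod_add m m).comp (h₁.prod h₂))

/-! ### Continuous functions on a product of compact spaces -/

/-- The function `(x, y) ↦ h₁ x * h₂ y` on `K₁ × K₂`. -/
def elementaryTensor {K₁ K₂ : Type*} [TopologicalSpace K₁] [TopologicalSpace K₂]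
    (h₁ : C(K₁, ℝ)) (h₂ : C(K₂, ℝ)) : C(K₁ × K₂, ℝ) :=
  h₁.comp ContinuousMap.fst * h₂.comp ContinuousMap.snd

theorem elementaryTensor_apply {K₁ K₂ : Type*} [TopologicalSpace K₁] [TopologicalSpace K₂]
    (h₁ : C(K₁, ℝ)) (h₂ : C(K₂, ℝ)) (p : K₁ × K₂) :
    elementaryTensor h₁ h₂ p = h₁ p.1 * h₂ p.2 := rfl

/-- Stone–Weierstrass: the elementary tensors span a dense subspace of `C(K₁ × K₂, ℝ)`. -/
theorem topologicalClosure_span_elementaryTensor {K₁ K₂ : Type*}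
    [TopologicalSpace K₁] [CompactSpace K₁] [T2Space K₁]
    [TopologicalSpace K₂] [CompactSpace K₂] [T2Space K₂] :
    (Submodule.span ℝ (Set.range fun a : C(K₁, ℝ) × C(K₂, ℝ) =>
      elementaryTensor a.1 a.2)).topologicalClosure = ⊤ := by
  let M : Submonoid C(K₁ × K₂, ℝ) :=
    { carrier := Set.range fun a : C(K₁, ℝ) × C(K₂, ℝ) => elementaryTensor a.1 a.2
      one_mem' := ⟨(1, 1), by ext; simp [elementaryTensor_apply]⟩
      mul_mem' := by
        rintro _ _ ⟨⟨a, b⟩, rfl⟩ ⟨⟨c, d⟩, rfl⟩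
        exact ⟨(a * c, b * d), by ext; simp [elementaryTensor_apply]; ring⟩ }
  have hsep : (Algebra.adjoin ℝ (M : Set C(K₁ × K₂, ℝ))).SeparatesPoints := by
    rintro ⟨x₁, x₂⟩ ⟨y₁, y₂⟩ hxy
    by_cases h : x₁ = y₁
    · have h' : x₂ ≠ y₂ := fun h' => hxy (by rw [h, h'])
      obtain ⟨g, hg⟩ := exists_continuous_zero_one_of_isClosed
        (isClosed_singleton (x := x₂)) (isClosed_singleton (x := y₂)) (by simpa using h')
      exact ⟨_, ⟨elementaryTensor 1 g, Algebra.subset_adjoin ⟨(1, g), rfl⟩, rfl⟩,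
        by simp [elementaryTensor_apply, hg.1 rfl, hg.2.1 rfl]⟩
    · obtain ⟨g, hg⟩ := exists_continuous_zero_one_of_isClosed
        (isClosed_singleton (x := x₁)) (isClosed_singleton (x := y₁)) (by simpa using h)
      exact ⟨_, ⟨elementaryTensor g 1, Algebra.subset_adjoin ⟨(g, 1), rfl⟩, rfl⟩,
        by simp [elementaryTensor_apply, hg.1 rfl, hg.2.1 rfl]⟩
  have h := ContinuousMap.subalgebra_topologicalClosure_eq_top_of_separatesPoints _ hsep
  rw [eq_top_iff]
  intro g _
  have hg : g ∈ (Algebra.adjoin ℝ (M : Set C(K₁ × K₂, ℝ))).topologicalClosure := h ▸ trivial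
  have hs : Subalgebra.toSubmodule (Algebra.adjoin ℝ (M : Set C(K₁ × K₂, ℝ)))
      = Submodule.span ℝ (M : Set C(K₁ × K₂, ℝ)) := by
    rw [Algebra.adjoin_eq_span, Submonoid.closure_eq]
  change g ∈ closure ((Submodule.span ℝ (M : Set C(K₁ × K₂, ℝ)) : Submodule ℝ _) : Set _)
  rw [← hs]
  exact hg

/-- Continuous functions on `K₁ × K₂` are measurable for the product of the Borel `σ`-algebras.
Without second countability this `σ`-algebra may be smaller than the Borel `σ`-algebra of the
product, but it makes the elementary tensors measurable, hence also their uniform limits. -/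
theorem stronglyMeasurable_of_prod {K₁ K₂ : Type*}
    [TopologicalSpace K₁] [CompactSpace K₁] [T2Space K₁] [MeasurableSpace K₁] [BorelSpace K₁]
    [TopologicalSpace K₂] [CompactSpace K₂] [T2Space K₂] [MeasurableSpace K₂] [BorelSpace K₂]
    (h : C(K₁ × K₂, ℝ)) : StronglyMeasurable h := by
  have hmem : h ∈ closure
      (Submodule.span ℝ (Set.range fun a : C(K₁, ℝ) × C(K₂, ℝ) =>
        elementaryTensor a.1 a.2) : Set _) := by
    rw [← Submodule.topologicalClosure_coe, topologicalClosure_span_elementaryTensor]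
    trivial
  obtain ⟨s, hs, hlim⟩ := mem_closure_iff_seq_limit.1 hmem
  refine stronglyMeasurable_of_tendsto Filter.atTop (f := fun n => ⇑(s n)) (fun n => ?_)
    (tendsto_pi_nhds.2 fun p => ((continuous_eval_const p).tendsto h).comp hlim)
  refine Submodule.span_induction (p := fun (g : C(K₁ × K₂, ℝ)) _ => StronglyMeasurable g)
    ?_ ?_ ?_ ?_ (hs n)
  · rintro _ ⟨⟨a, b⟩, rfl⟩
    exact ((a.continuous.measurable.comp measurable_fst).mul
      (b.continuous.measurable.comp measurable_snd)).stronglyMeasurable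
  · exact stronglyMeasurable_zero
  · exact fun x y _ _ hx hy => hx.add hy
  · exact fun c x _ hx => hx.const_smul c

/-- Integration of `g ∘ ψ` against an integrable weight `k` is continuous in `g ∈ C(X, 𝕜)`. -/
theorem exists_clm_integral_mul {Ω X 𝕜 : Type*} [RCLike 𝕜] [MeasurableSpace Ω] {ν : Measure Ω}
    [TopologicalSpace X] [CompactSpace X] {k : Ω → 𝕜} (hk : Integrable k ν) {ψ : Ω → X}
    (hψ : ∀ g : C(X, 𝕜), AEStronglyMeasurable (fun ω => g (ψ ω)) ν) :
    ∃ L : C(X, 𝕜) →L[𝕜] 𝕜, ∀ g, L g = ∫ ω, g (ψ ω) * k ω ∂ν := by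
  have hint : ∀ g : C(X, 𝕜), Integrable (fun ω => g (ψ ω) * k ω) ν := fun g =>
    hk.bdd_mul (hψ g) (Filter.Eventually.of_forall fun ω => g.norm_coe_le_norm (ψ ω))
  refine ⟨LinearMap.mkContinuous
    { toFun := fun g => ∫ ω, g (ψ ω) * k ω ∂ν
      map_add' := fun g g' => ?_
      map_smul' := fun c g => ?_ } (∫ ω, ‖k ω‖ ∂ν) fun g => ?_, fun g => rfl⟩
  · rw [← integral_add (hint g) (hint g')]
    exact integral_congr_ae (Filter.Eventually.of_forall fun ω => add_mul _ _ _)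
  · rw [RingHom.id_apply, smul_eq_mul, ← integral_const_mul]
    exact integral_congr_ae (Filter.Eventually.of_forall fun ω => mul_assoc _ _ _)
  · rw [mul_comm, ← integral_const_mul]
    refine norm_integral_le_of_norm_le (hk.norm.const_mul _)
      (Filter.Eventually.of_forall fun ω => ?_)
    rw [norm_mul]
    gcongr
    exact g.norm_coe_le_norm _

/-! ### Fourier coefficients and densities on the circle -/

/-- Bessel's inequality for the characters pulled back along `f`, which are orthonormal in `L²(μ)`
because `f` maps `μ` to Haar measure. -/
theorem summable_norm_sq_integral_fourier {K : Type*} [TopologicalSpace K] [CompactSpace K]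
    [MeasurableSpace K] [BorelSpace K] {μ : Measure K} [IsFiniteMeasure μ]
    (f : C(K, UnitAddCircle)) (hf : MeasurePreserving f μ haarAddCircle) (h : C(K, ℂ)) :
    Summable fun n : ℤ => ‖∫ x, h x * fourier (-n) (f x) ∂μ‖ ^ 2 := by
  let v : ℤ → Lp ℂ 2 μ := fun n => ContinuousMap.toLp 2 μ ℂ ((fourier n).comp f)
  have hv : Orthonormal ℂ v := by
    have h0 := orthonormal_fourier (T := (1 : ℝ))
    rw [orthonormal_iff_ite] at h0 ⊢
    intro i j
    rw [← h0 i j, ContinuousMap.inner_toLp, ContinuousMap.inner_toLp, ← hf.map_eq,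
      integral_map hf.measurable.aemeasurable (by fun_prop)]
    rfl
  refine (hv.inner_products_summable (x := ContinuousMap.toLp 2 μ ℂ h)).congr fun n => ?_
  rw [ContinuousMap.inner_toLp]
  simp_rw [fourier_neg]
  rfl

theorem integral_fourier_mul_fourier (n m : ℤ) :
    ∫ z : UnitAddCircle, fourier n z * fourier m z ∂haarAddCircle = if n = -m then 1 else 0 := by
  have h0 := orthonormal_iff_ite.1 (orthonormal_fourier (T := (1 : ℝ))) (-m) n
  rw [ContinuousMap.inner_toLp] at h0
  simp_rw [← fourier_neg, neg_neg] at h0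
  rw [h0]
  simp only [eq_comm]

/-- If the image under `φ` of the signed measure `h ν` has a continuous density `u` with respect to
`m = φ(ν)`, then `u` is bounded above by any bound `M` of `|h|`. The proof tests the defining
identity on `g = (u - M)⁺`, which gives `∫ g² ≤ 0`. -/
theorem le_of_forall_integral_eq {Ω X : Type*} [MeasurableSpace Ω] {ν : Measure Ω}
    [TopologicalSpace X] [CompactSpace X] [MeasurableSpace X] [BorelSpace X]
    [SecondCountableTopology X] {m : Measure X}
    [IsFiniteMeasure m] [m.IsOpenPosMeasure] {φ : Ω → X} (hφ : MeasurePreserving φ ν m)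
    {h : Ω → ℝ} (hm : AEStronglyMeasurable h ν) {M : ℝ} (hM : ∀ ω, ‖h ω‖ ≤ M) (u : C(X, ℝ))
    (hu : ∀ g : C(X, ℝ), ∫ ω, h ω * g (φ ω) ∂ν = ∫ x, u x * g x ∂m) (x : X) : u x ≤ M := by
  have hint : ∀ g : C(X, ℝ), Integrable g m := fun g =>
    g.continuous.integrable_of_hasCompactSupport (HasCompactSupport.of_compactSpace g)
  let g : C(X, ℝ) := ⟨fun x => max (u x - M) 0, by fun_prop⟩
  have hg0 : ∀ x, 0 ≤ g x := fun x => le_max_right _ _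
  have hgφ : Integrable (fun ω => g (φ ω)) ν := hφ.integrable_comp_of_integrable (hint g)
  have h1 : ∫ x, u x * g x ∂m ≤ ∫ x, M * g x ∂m := by
    have h2 : ∫ x, M * g x ∂m = ∫ ω, M * g (φ ω) ∂ν := by
      rw [← hφ.map_eq, integral_map hφ.measurable.aemeasurable (by fun_prop)]
    rw [← hu, h2]
    refine integral_mono (hgφ.bdd_mul hm (Filter.Eventually.of_forall hM)) (hgφ.const_mul M)
      fun ω => ?_
    exact mul_le_mul_of_nonneg_right ((le_abs_self _).trans (hM ω)) (hg0 _)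
  have h3 : ∫ x, (g * g) x ∂m ≤ 0 := by
    have h4 : ∀ x, (g * g) x = u x * g x - M * g x := fun x => by
      change max (u x - M) 0 * max (u x - M) 0 =
        u x * max (u x - M) 0 - M * max (u x - M) 0
      rcases le_total (u x - M) 0 with h | h
      · rw [max_eq_right h]; ring
      · rw [max_eq_left h]; ring
    simp_rw [h4]
    have h5 := integral_sub (hint (u * g)) ((hint g).const_mul M)
    simp only [ContinuousMap.mul_apply] at h5
    linarith
  by_contra! hx
  have hpos := (g * g).continuous.integral_pos_of_hasCompactSupport_nonneg_nonzero (μ := m) (x := x)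
    (HasCompactSupport.of_compactSpace _) (fun y => mul_self_nonneg (g y)) (by
      have : 0 < g x := lt_max_of_lt_left (by linarith)
      exact (mul_pos this this).ne')
  linarith

/-! ### Averaging over the fibres of `f₁ + f₂` -/

section Product

variable {K₁ K₂ : Type*}
  [TopologicalSpace K₁] [CompactSpace K₁] [T2Space K₁] [MeasurableSpace K₁] [BorelSpace K₁]
  [TopologicalSpace K₂] [CompactSpace K₂] [T2Space K₂] [MeasurableSpace K₂] [BorelSpace K₂]
  {μ₁ : Measure K₁} [IsFiniteMeasure μ₁] {μ₂ : Measure K₂} [IsFiniteMeasure μ₂]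
  {f₁ : C(K₁, UnitAddCircle)} {f₂ : C(K₂, UnitAddCircle)}

theorem integrable_of_prod (h : C(K₁ × K₂, ℝ)) : Integrable h (μ₁.prod μ₂) :=
  Integrable.of_bound (stronglyMeasurable_of_prod h).aestronglyMeasurable ‖h‖
    (Filter.Eventually.of_forall fun p => h.norm_coe_le_norm p)

/-- For an elementary tensor, the image of `(h₁ ⊗ h₂) (μ₁ × μ₂)` under `f₁ + f₂` is the convolution of
the images of `h₁ μ₁` and `h₂ μ₂`. By Bessel's inequality both have square summable Fourier
coefficients, so those of the convolution are absolutely summable and it has a continuous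
density. -/
theorem exists_density_elementaryTensor (hf₁ : MeasurePreserving f₁ μ₁ haarAddCircle)
    (hf₂ : MeasurePreserving f₂ μ₂ haarAddCircle) (h₁ : C(K₁, ℝ)) (h₂ : C(K₂, ℝ)) :
    ∃ u : C(UnitAddCircle, ℝ), ∀ g : C(UnitAddCircle, ℝ),
      ∫ p, elementaryTensor h₁ h₂ p * g (f₁ p.1 + f₂ p.2) ∂(μ₁.prod μ₂) =
        ∫ z, u z * g z ∂haarAddCircle := by
  let a : ℤ → ℂ := fun n => ∫ x, (h₁ x : ℂ) * fourier (-n) (f₁ x) ∂μ₁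
  let b : ℤ → ℂ := fun n => ∫ x, (h₂ x : ℂ) * fourier (-n) (f₂ x) ∂μ₂
  have ha : Summable fun n => ‖a n‖ ^ 2 :=
    summable_norm_sq_integral_fourier f₁ hf₁ ⟨fun x => (h₁ x : ℂ), by fun_prop⟩
  have hb : Summable fun n => ‖b n‖ ^ 2 :=
    summable_norm_sq_integral_fourier f₂ hf₂ ⟨fun x => (h₂ x : ℂ), by fun_prop⟩
  have hc : Summable fun n : ℤ => (a n * b n) • (fourier n : C(UnitAddCircle, ℂ)) := by
    refine Summable.of_norm_bounded (ha.add hb) fun n => ?_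
    rw [norm_smul, fourier_norm, mul_one, norm_mul]
    nlinarith [sq_nonneg (‖a n‖ - ‖b n‖), sq_nonneg ‖a n‖, sq_nonneg ‖b n‖]
  let v : C(UnitAddCircle, ℂ) := ∑' n : ℤ, (a n * b n) • fourier n
  have hintC : ∀ g : C(UnitAddCircle, ℂ), Integrable g haarAddCircle := fun g =>
    g.continuous.integrable_of_hasCompactSupport (HasCompactSupport.of_compactSpace g)
  have hφ : Measurable fun p : K₁ × K₂ => f₁ p.1 + f₂ p.2 :=
    (f₁.continuous.measurable.comp measurable_fst).add
      (f₂.continuous.measurable.comp measurable_snd)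
  obtain ⟨L₁, hL₁⟩ := exists_clm_integral_mul (hintC v) (ψ := id)
    fun g => g.continuous.aestronglyMeasurable
  obtain ⟨L₂, hL₂⟩ := exists_clm_integral_mul (𝕜 := ℂ) (X := UnitAddCircle)
    (integrable_of_prod (μ₁ := μ₁) (μ₂ := μ₂) (elementaryTensor h₁ h₂)).ofReal
    (ψ := fun p : K₁ × K₂ => f₁ p.1 + f₂ p.2)
    fun g => (g.continuous.measurable.comp hφ).aestronglyMeasurable
  -- Integration against `v` and against the image measure agree on characters, hence everywhere.
  have hL : L₁ = L₂ := by
    refine ContinuousLinearMap.ext_on (s := Set.range (fourier (T := (1 : ℝ)))) ?_ ?_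
    · rw [Submodule.dense_iff_topologicalClosure_eq_top]
      exact span_fourier_closure_eq_top
    rintro _ ⟨m, rfl⟩
    obtain ⟨L₃, hL₃⟩ := exists_clm_integral_mul (hintC (fourier m)) (ψ := id)
      fun g => g.continuous.aestronglyMeasurable
    have hv : L₁ (fourier m) = a (-m) * b (-m) := by
      have h1 : L₁ (fourier m) = L₃ v := by
        rw [hL₁, hL₃]
        simp only [id, mul_comm]
      have h2 : ∀ n : ℤ, L₃ ((a n * b n) • fourier n) = if n = -m then a n * b n else 0 := by
        intro n
        rw [map_smul, hL₃]
        simp only [id]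
        rw [integral_fourier_mul_fourier, smul_eq_mul, mul_ite, mul_one, mul_zero]
      rw [h1, L₃.map_tsum hc]
      simp_rw [h2]
      rw [tsum_ite_eq]
    rw [hv, hL₂]
    simp only [a, b, neg_neg]
    rw [← integral_prod_mul]
    refine integral_congr_ae (Filter.Eventually.of_forall fun p => ?_)
    have hadd : fourier m (f₁ p.1 + f₂ p.2) = fourier m (f₁ p.1) * fourier m (f₂ p.2) := by
      simp only [fourier_apply, smul_add, toCircle_add, Circle.coe_mul]
    simp only [hadd, elementaryTensor_apply, RCLike.ofReal_eq_complex_ofReal, Complex.ofReal_mul]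
    ring
  refine ⟨⟨fun z => (v z).re, by fun_prop⟩, fun g => ?_⟩
  have key := congr(Complex.re ($hL ⟨fun z => (g z : ℂ), by fun_prop⟩))
  rw [hL₁, hL₂] at key
  -- For real `g` the integral against the image measure is real, so `v` may be replaced by `re v`.
  have hre : ∀ g : C(UnitAddCircle, ℂ), (∫ z, g z ∂haarAddCircle).re =
      ∫ z, (g z).re ∂haarAddCircle := fun g => (integral_re (hintC g)).symm
  have h1 := hre (⟨fun z => (g z : ℂ), by fun_prop⟩ * v)
  simp only [ContinuousMap.mul_apply, ContinuousMap.coe_mk, Complex.re_ofReal_mul] at h1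
  simp only [ContinuousMap.coe_mk, id, RCLike.ofReal_eq_complex_ofReal, ← Complex.ofReal_mul,
    integral_complex_ofReal, Complex.ofReal_re] at key
  rw [h1] at key
  simp only [ContinuousMap.coe_mk, mul_comm _ (g _)]
  exact key.symm

/-- Composition with `f₁ + f₂`, from functions on the circle to functions on `K₁ × K₂`, has a
continuous linear left inverse: the map taking `h` to the continuous density of the image of
`h (μ₁ × μ₂)` under `f₁ + f₂`. -/
theorem exists_leftInverse_comp_add (hf₁ : MeasurePreserving f₁ μ₁ haarAddCircle)
    (hf₂ : MeasurePreserving f₂ μ₂ haarAddCircle) :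
    ∃ R : C(K₁ × K₂, ℝ) →L[ℝ] C(UnitAddCircle, ℝ), ∀ g : C(UnitAddCircle, ℝ),
      R (g.comp (f₁.comp ContinuousMap.fst + f₂.comp ContinuousMap.snd)) = g := by
  let φ : C(K₁ × K₂, UnitAddCircle) := f₁.comp ContinuousMap.fst + f₂.comp ContinuousMap.snd
  have hφ : MeasurePreserving φ (μ₁.prod μ₂) haarAddCircle :=
    measurePreserving_add_of_prod hf₁ hf₂
  have hint : ∀ g : C(UnitAddCircle, ℝ), Integrable g haarAddCircle := fun g =>
    g.continuous.integrable_of_hasCompactSupport (HasCompactSupport.of_compactSpace g)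
  choose L hL using fun g : C(UnitAddCircle, ℝ) => exists_clm_integral_mul (𝕜 := ℝ)
    (integrable_of_prod (μ₁ := μ₁) (μ₂ := μ₂) (g.comp φ)) (ψ := id)
    fun h => (stronglyMeasurable_of_prod h).aestronglyMeasurable
  choose L' hL' using fun g : C(UnitAddCircle, ℝ) => exists_clm_integral_mul (𝕜 := ℝ)
    (hint g) (ψ := id) fun h => h.continuous.aestronglyMeasurable
  -- `Γ` is the graph of the left inverse: `w.2` is the density of the image of `w.1 (μ₁ × μ₂)`.
  let Γ : Submodule ℝ (C(K₁ × K₂, ℝ) × C(UnitAddCircle, ℝ)) :=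
    ⨅ g, ((L g).comp (.fst ℝ _ _) - (L' g).comp (.snd ℝ _ _)).ker
  have hΓ : ∀ w, w ∈ Γ ↔ ∀ g : C(UnitAddCircle, ℝ), ∫ p, w.1 p * g (φ p) ∂(μ₁.prod μ₂) =
      ∫ z, w.2 z * g z ∂haarAddCircle := by
    intro w
    simp only [Γ, Submodule.mem_iInf, LinearMap.mem_ker]
    refine forall_congr' fun g => ?_
    change L g w.1 - L' g w.2 = 0 ↔ _
    rw [sub_eq_zero, hL, hL']
    rfl
  have hΓcl : IsClosed (Γ : Set (C(K₁ × K₂, ℝ) × C(UnitAddCircle, ℝ))) := by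
    simp only [Γ, Submodule.coe_iInf]
    exact isClosed_iInter fun g => ContinuousLinearMap.isClosed_ker _
  have : CompleteSpace Γ := hΓcl.completeSpace_coe
  have hle : ∀ w ∈ Γ, ∀ z, w.2 z ≤ ‖w.1‖ := fun w hw z =>
    le_of_forall_integral_eq hφ (stronglyMeasurable_of_prod w.1).aestronglyMeasurable
      w.1.norm_coe_le_norm w.2 ((hΓ w).1 hw) z
  -- As the density is bounded by the function, the first projection is isometric on the closed
  -- subspace `Γ`. Its range is therefore closed, and it contains the elementary tensors.
  let π : Γ →ₗᵢ[ℝ] C(K₁ × K₂, ℝ) :=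
    { toLinearMap := LinearMap.fst ℝ _ _ ∘ₗ Γ.subtype
      norm_map' := fun w => by
        refine (max_eq_left ?_).symm
        refine (ContinuousMap.norm_le _ (norm_nonneg _)).2 fun z => abs_le'.2 ⟨hle _ w.2 z, ?_⟩
        simpa using hle _ (-w).2 z }
  have hsurj : Function.Surjective π := by
    have hcl : IsClosed (LinearMap.range π.toLinearMap : Set C(K₁ × K₂, ℝ)) :=
      π.isometry.isClosedEmbedding.isClosed_range
    have htop : LinearMap.range π.toLinearMap = ⊤ := by
      rw [eq_top_iff, ← topologicalClosure_span_elementaryTensor]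
      refine Submodule.topologicalClosure_minimal _ (Submodule.span_le.2 ?_) hcl
      rintro _ ⟨⟨h₁, h₂⟩, rfl⟩
      obtain ⟨u, hu⟩ := exists_density_elementaryTensor hf₁ hf₂ h₁ h₂
      exact ⟨⟨(elementaryTensor h₁ h₂, u), (hΓ _).2 hu⟩, rfl⟩
    exact LinearMap.range_eq_top.1 htop
  let e := LinearIsometryEquiv.ofSurjective π hsurj
  refine ⟨(ContinuousLinearMap.snd ℝ _ _).comp
    (Γ.subtypeL.comp e.symm.toContinuousLinearEquiv.toContinuousLinearMap), fun g => ?_⟩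
  have hw : (g.comp φ, g) ∈ Γ := by
    refine (hΓ _).2 fun g' => ?_
    rw [← hφ.map_eq, integral_map hφ.measurable.aemeasurable (by fun_prop)]
    rfl
  have he : e.symm (g.comp φ) = ⟨(g.comp φ, g), hw⟩ :=
    e.symm_apply_eq.2 rfl
  exact congr(($he).1.2)

end Product

/-! ### Assembling the complemented copy -/

/-- The interval is a retract of the circle: it embeds as a half circle, onto which the circle is
folded. -/
theorem unitInterval_retract_unitAddCircle :
    ∃ (s : C(Set.Icc (0 : ℝ) 1, UnitAddCircle)) (q : C(UnitAddCircle, Set.Icc (0 : ℝ) 1)),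
      ∀ t, q (s t) = t := by
  -- The norm on the circle is the distance to `0` and takes values in `[0, 1/2]`.
  refine ⟨⟨fun t => ((t / 2 : ℝ) : UnitAddCircle), by fun_prop⟩,
    ⟨fun z => ⟨2 * ‖z‖, by positivity, ?_⟩, by fun_prop⟩, fun t => ?_⟩
  · have := AddCircle.norm_le_half_period (x := z) 1 one_ne_zero
    norm_num at this
    linarith
  · ext
    have h0 := t.2.1
    have h1 := t.2.2
    change 2 * ‖((t / 2 : ℝ) : UnitAddCircle)‖ = t
    rw [(AddCircle.norm_coe_eq_abs_iff _ one_ne_zero).2] <;> rw [abs_of_nonneg (by positivity)]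
    · ring
    · rw [abs_one]; linarith

/-- Precomposition with `f`, as a continuous linear map. -/
def precompCLM {X Y : Type*} [TopologicalSpace X] [TopologicalSpace Y] (f : C(X, Y)) :
    C(Y, ℝ) →L[ℝ] C(X, ℝ) :=
  ⟨(ContinuousMap.compRightAlgHom ℝ ℝ f).toLinearMap, ContinuousMap.continuous_precomp f⟩

/-- A continuous linear map with a continuous linear left inverse is an isomorphism onto a
complemented subspace. -/
theorem exists_closedComplemented_of_leftInverse {𝕜 E F : Type*} [NontriviallyNormedField 𝕜]
    [NormedAddCommGroup E] [NormedSpace 𝕜 E] [NormedAddCommGroup F] [NormedSpace 𝕜 F]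
    (L : F →L[𝕜] E) (R : E →L[𝕜] F) (h : Function.LeftInverse R L) :
    ∃ S : Submodule 𝕜 E, S.ClosedComplemented ∧ Nonempty (S ≃L[𝕜] F) := by
  refine ⟨L.range, ⟨(L.comp R).codRestrict _ fun x => ⟨R x, rfl⟩, ?_⟩, ⟨?_⟩⟩
  · rintro ⟨_, y, rfl⟩
    exact Subtype.ext (congrArg L (h y))
  · exact (ContinuousLinearEquiv.equivOfInverse
      (L.codRestrict L.range fun x => ⟨x, rfl⟩) (R.comp L.range.subtypeL) h (by
        rintro ⟨_, y, rfl⟩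
        exact Subtype.ext (congrArg L (h y)))).symm

theorem corollary1p3 {K₁ K₂ : Type*}
    [TopologicalSpace K₁] [CompactSpace K₁] [T2Space K₁]
    [TopologicalSpace K₂] [CompactSpace K₂] [T2Space K₂]
    (h₁ : ¬ IsScatteredSpace K₁) (h₂ : ¬ IsScatteredSpace K₂) :
    ∃ E : Submodule ℝ C(K₁ × K₂, ℝ),
      E.ClosedComplemented ∧ Nonempty (E ≃L[ℝ] C(Set.Icc (0 : ℝ) 1, ℝ)) := by
  borelize K₁ K₂
  obtain ⟨f₁, hf₁⟩ := exists_surjective_unitAddCircle h₁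
  obtain ⟨f₂, hf₂⟩ := exists_surjective_unitAddCircle h₂
  obtain ⟨μ₁, _, hμ₁⟩ := exists_measurePreserving_of_surjective haarAddCircle f₁ hf₁
  obtain ⟨μ₂, _, hμ₂⟩ := exists_measurePreserving_of_surjective haarAddCircle f₂ hf₂
  obtain ⟨R, hR⟩ := exists_leftInverse_comp_add hμ₁ hμ₂
  obtain ⟨s, q, hsq⟩ := unitInterval_retract_unitAddCircle
  let φ : C(K₁ × K₂, UnitAddCircle) := f₁.comp ContinuousMap.fst + f₂.comp ContinuousMap.snd
  refine exists_closedComplemented_of_leftInverse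
    (precompCLM (q.comp φ))
    ((precompCLM s).comp R) fun g => ?_
  ext t
  have := congr($(hR (g.comp q)) (s t))
  refine Eq.trans this ?_
  exact congrArg g (hsq t)
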